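/- Let $N\ge 1$ and consider the following causal bandit environment $\nu$ with parameters $p_1,\dots,p_N\in[0,1]$ and $\Delta>0$. There are $N$ independent variables $X_1,\dots,X_N$ with values in $\{1,2\}$ and $P(X_i=1)=p_i$, and the reward is $Y=\Delta X_1+\eta$, where $\eta\sim\mathcal N(0,1)$ is independent of the variables. The arms are the $3^N$ interventions $do(X_1=i_1,\dots,X_N=i_N)$ with $i_1,\dots,i_N\in\{0,1,2\}$, where $i_j=0$ means that $X_j$ is not set and keeps its marginal law. Let $\mu_a$ be the expected reward of the arm $a$. Standard (non-causal) UCB uses only the observed rewards: it pulls every arm once, and then in each round $t+1$ it pulls an arm $a$ that maximizes $\hat\mu_a(t)+\sqrt{2\log(1/\delta_t)/T_a(t)}$, with ties (also in the order of the initial pulls) broken in any way, where $T_a(t)$ is the number of pulls of $a$ in the first $t$ rounds and $\hat\mu_a(t)$ is the average of the rewards that these pulls gave. The confidence level is either $\delta_t=1/t$ (anytime version) or $\delta_t=1/T^2$ (version with known horizon $T$). Theorem. For every $\epsilon>0$ there is a constant $C_\epsilon>0$, depending only on $\epsilon$, such that for all $N\ge1$ and all $T\ge 3^N$ there is a $\Delta$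 with $0<\Delta\le 1/2$ (so that all $\mu_a$ lie in $[0,1]$) such that, for all $p_1,\dots,p_N\in[0,1]$ and for both versions of standard UCB, running it for $T$ steps in $\nu$ gives expected cumulative regret $$\mathbb E[R_T]=T\max_a\mu_a-\sum_{t=1}^T\mathbb E[\mu_{a_t}]\;\ge\; C_\epsilon\,\sqrt{3^N}\,T^{1/2-\epsilon}.$$ -/

import Mathlib

open MeasureTheory ProbabilityTheory

namespace CausalBandit

/-- The two values `1, 2` of a variable, encoded by `Fin 2` (index `0` is the value `1`,
index `1` is the value `2`). -/
noncomputable def value (v : Fin 2) : ℝ := (v.val : ℝ) + 1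

/-- The arms: interventions `do(X₁ = i₁, …, X_N = i_N)`. `none` means that the variable is not
set (the symbol `0`), `some v` that it is set to `v`. There are `3 ^ N` of them. -/
abbrev Intervention (N : ℕ) : Type := Fin N → Option (Fin 2)

/-- The law on `{1, 2}` that gives the value `1` probability `q`. -/
noncomputable def marginal (q : unitInterval) : Measure (Fin 2) :=
  ENNReal.ofReal (q : ℝ) • Measure.dirac 0 + ENNReal.ofReal (1 - (q : ℝ)) • Measure.dirac 1

/-- The law of one variable: its marginal if it is not intervened on, a point mass otherwise. -/
noncomputable def coordLaw (q : unitInterval) : Option (Fin 2) → Measure (Fin 2)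
  | none => marginal q
  | some v => Measure.dirac v

/-- The law of `(X₁, …, X_N)` under the intervention `a`, the variables being independent with
`P(X_i = 1) = p i` when nothing is set. -/
noncomputable def doLaw {N : ℕ} (p : Fin N → unitInterval) (a : Intervention N) :
    Measure (Fin N → Fin 2) :=
  Measure.pi fun i => coordLaw (p i) (a i)

/-- The law of the reward `Y = Δ X₁ + N(0, 1)` under the intervention `a`. The variable `X₁` is
the coordinate with index `0`; the noise is independent of the variables. -/
noncomputable def rewardLaw {N : ℕ} [NeZero N] (Δ : ℝ) (p : Fin N → unitInterval)
    (a : Intervention N) : Measure ℝ :=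
  ((doLaw p a).prod (gaussianReal 0 1)).map fun z => Δ * value (z.1 0) + z.2

/-- The expected reward `μ_a` of the arm `a`. -/
noncomputable def armMean {N : ℕ} [NeZero N] (Δ : ℝ) (p : Fin N → unitInterval)
    (a : Intervention N) : ℝ :=
  ∫ y, y ∂(rewardLaw Δ p a)

/-- The rewards of a multi-armed bandit whose arm `a` has reward law `law a`: `Y a n` is the
reward received when the arm `a` is pulled for the `(n + 1)`-st time; all of them are independent,
and those of the arm `a` have law `law a`. -/
structure IsRewardTable {K Ω : Type*} [MeasurableSpace Ω] (P : Measure Ω) (law : K → Measure ℝ)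
    (Y : K → ℕ → Ω → ℝ) : Prop where
  measurable : ∀ a n, Measurable (Y a n)
  map_eq : ∀ a n, P.map (Y a n) = law a
  indep : iIndepFun (fun i : K × ℕ => Y i.1 i.2) P

/-- The number of pulls of the arm `a` in the first `t` rounds, when `A s` is the arm pulled in
round `s + 1`. -/
def pulls {K : Type*} [DecidableEq K] (A : ℕ → K) (t : ℕ) (a : K) : ℕ :=
  ((Finset.range t).filter fun s => A s = a).card

/-- The empirical mean of the arm `a` after `t` rounds; `y a n` is the `(n + 1)`-st reward that
the arm `a` yields. -/
noncomputable def empMean {K : Type*} [DecidableEq K] (y : K → ℕ → ℝ) (A : ℕ → K) (t : ℕ)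
    (a : K) : ℝ :=
  (∑ n ∈ Finset.range (pulls A t a), y a n) / (pulls A t a : ℝ)

/-- The upper confidence bound of the arm `a` after `t` rounds at confidence level `δ`: the
empirical mean plus `√(2 log (1/δ) / (number of pulls))`, and `+∞` for an arm that has not been
pulled yet (so that every arm is pulled once first). -/
noncomputable def ucbIndex {K : Type*} [DecidableEq K] (δ : ℝ) (y : K → ℕ → ℝ) (A : ℕ → K)
    (t : ℕ) (a : K) : EReal :=
  if pulls A t a = 0 then ⊤
  else ((empMean y A t a + Real.sqrt (2 * Real.log (1 / δ) / (pulls A t a : ℝ)) : ℝ) : EReal)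

/-- The two usual choices of the confidence level in the UCB algorithm. -/
inductive UCBVersion : Type
  | anytime
  | fixedHorizon

/-- The confidence level used after `t` completed rounds out of `T`: `1 / t` in the anytime
version (with the bonus `√(2 log t / n)`), and `1 / T ^ 2` in the fixed-horizon version (with the
bonus `√(4 log T / n)`). -/
noncomputable def UCBVersion.level : UCBVersion → ℕ → ℕ → ℝ
  | .anytime, _, t => 1 / (t : ℝ)
  | .fixedHorizon, T, _ => 1 / (T : ℝ) ^ 2

/-- The sequence of arms `A` is a run of UCB for `T` rounds on the rewards `y`: in each round an
arm with the largest upper confidence bound is pulled (ties are broken in any way). -/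
def IsUCBRun {K : Type*} [DecidableEq K] (v : UCBVersion) (T : ℕ) (y : K → ℕ → ℝ)
    (A : ℕ → K) : Prop :=
  ∀ t < T, ∀ b, ucbIndex (v.level T t) y A t b ≤ ucbIndex (v.level T t) y A t (A t)

/-- The expected cumulative regret `T μ* - ∑_{t ≤ T} E[μ_{a_t}]`. -/
noncomputable def expectedRegret {K Ω : Type*} [MeasurableSpace Ω] (P : Measure Ω) (mean : K → ℝ)
    (A : ℕ → Ω → K) (T : ℕ) : ℝ :=
  (T : ℝ) * (⨆ a, mean a) - ∑ t ∈ Finset.range T, ∫ ω, mean (A t ω) ∂P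

end CausalBandit

/-!
Write `K = 3 ^ N` for the number of arms. The centred rewards are sub-Gaussian with variance proxy
`1 + Δ² / 4`, so with probability at least `1 / 2` no arm is unlucky by a fraction `1 - ε / 6` of
its exploration bonus during its first `T ^ (1 - ε) / K` pulls, and no arm is ever lucky by two
bonuses. In the second half of the run some arm that has already been pulled `T / (4 K)` times is
pulled once more; as `2 Δ ≤ √(K / T)`, its index is at most of the order of its bonus. An arm with
far fewer than `ε² T / K` pulls would have a larger index, because a fraction `ε / 6` of its much
larger bonus survives its bad luck. Hence every arm, good or bad, is pulled at least
`T ^ (1 - ε) / K` times. A third of the arms has gap `Δ = √(K / T) / 2`, which gives regret of the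
order `Δ T ^ (1 - ε) ≈ √K T ^ (1 / 2 - ε)`. For horizons too short to absorb the constants, the
initial pull of every arm suffices.
-/

namespace CausalBandit

section Pulls

variable {K : Type*} [DecidableEq K]

theorem pulls_eq_count (A : ℕ → K) (t : ℕ) (a : K) : pulls A t a = Nat.count (A · = a) t :=
  (Nat.count_eq_card_filter_range _ _).symm

theorem pulls_mono (A : ℕ → K) (a : K) : Monotone fun t => pulls A t a := by
  simpa only [pulls_eq_count] using Nat.count_monotone (A · = a)

theorem pulls_le (A : ℕ → K) (t : ℕ) (a : K) : pulls A t a ≤ t := by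
  simpa only [pulls_eq_count] using Nat.count_le (p := (A · = a))

theorem injective_pulls_self (A : ℕ → K) : Function.Injective fun t => (A t, pulls A t (A t)) := by
  intro s t h
  obtain ⟨harm, hcount⟩ := Prod.mk.inj h
  rw [pulls_eq_count, pulls_eq_count, harm] at hcount
  exact Nat.count_injective (p := (A · = A t)) harm rfl hcount

theorem exists_le_pulls_of_card_mul_lt (A : ℕ → K) {S : Finset K} {s T q : ℕ}
    (hS : ∀ t, s ≤ t → t < T → A t ∈ S) (h : S.card * q < T - s) :
    ∃ t, s ≤ t ∧ t < T ∧ q ≤ pulls A t (A t) := by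
  by_contra! hlt
  have hcard : (Finset.Ico s T).card ≤ (S ×ˢ Finset.range q).card := by
    refine Finset.card_le_card_of_injOn _ (fun t ht => ?_) (injective_pulls_self A).injOn
    obtain ⟨hst, htT⟩ := Finset.mem_Ico.1 (Finset.mem_coe.1 ht)
    simpa using ⟨hS t hst htT, hlt t hst htT⟩
  rw [Nat.card_Ico, Finset.card_product, Finset.card_range] at hcard
  omega

theorem sum_range_comp_eq_sum_pulls_mul [Fintype K] (A : ℕ → K) (T : ℕ) (f : K → ℝ) :
    ∑ t ∈ Finset.range T, f (A t) = ∑ a, pulls A T a * f a := by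
  simp_rw [← Finset.sum_fiberwise' (Finset.range T) A f, Finset.sum_const, nsmul_eq_mul, pulls]

end Pulls

section UCB

variable {K : Type*} [DecidableEq K] {v : UCBVersion} {T : ℕ} {y : K → ℕ → ℝ} {A : ℕ → K}

theorem ucbIndex_of_pulls_pos (δ : ℝ) {t : ℕ} {a : K} (h : 0 < pulls A t a) :
    ucbIndex δ y A t a =
      ((empMean y A t a + √(2 * Real.log (1 / δ) / pulls A t a) : ℝ) : EReal) :=
  if_neg h.ne'

theorem IsUCBRun.pulls_pos_of_pulls_self_pos (hrun : IsUCBRun v T y A) {t : ℕ} (ht : t < T)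
    (h : 0 < pulls A t (A t)) (b : K) : 0 < pulls A t b := by
  by_contra! hb
  have hidx := hrun t ht b
  rw [ucbIndex_of_pulls_pos _ h, ucbIndex, if_pos (Nat.le_zero.1 hb), top_le_iff] at hidx
  exact EReal.coe_ne_top _ hidx

theorem IsUCBRun.pulls_pos_of_card_le [Fintype K] (hrun : IsUCBRun v T y A)
    (hT : Fintype.card K ≤ T) (b : K) : 0 < pulls A T b := by
  by_contra! hb
  have hnever : ∀ t < T, A t ≠ b := by
    intro t ht hAt
    rw [pulls_eq_count] at hb
    exact absurd (Nat.count_strict_mono (p := (A · = b)) hAt ht) (by omega)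
  have hcard : (Finset.univ.erase b).card * 1 < T - 0 := by
    have hpos : 0 < Fintype.card K := Fintype.card_pos_iff.2 ⟨b⟩
    rw [Finset.card_erase_of_mem (Finset.mem_univ b), Finset.card_univ]
    omega
  obtain ⟨t, -, htT, ht⟩ := exists_le_pulls_of_card_mul_lt A
    (fun t _ ht => Finset.mem_erase.2 ⟨hnever t ht, Finset.mem_univ _⟩) hcard
  have hlt := hrun.pulls_pos_of_pulls_self_pos htT ht b
  exact absurd (hlt.trans_le (pulls_mono A b htT.le)) hb.not_gt

/-- A lower bound for the factor `√(2 log (1 / δ_t))` of the exploration bonus, valid for both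
versions of UCB in the second half `T / 2 ≤ t` of the run. -/
noncomputable def minBonus (T : ℕ) : ℝ := √(2 * Real.log ((T : ℝ) / 2))

theorem minBonus_le_sqrt_two_mul_log_level (v : UCBVersion) {T t : ℕ} (hT : 1 ≤ T)
    (ht : (T : ℝ) / 2 ≤ t) :
    minBonus T ≤ √(2 * Real.log (1 / v.level T t)) := by
  have hT' : (1 : ℝ) ≤ T := by exact_mod_cast hT
  refine Real.sqrt_le_sqrt (mul_le_mul_of_nonneg_left ?_ zero_le_two)
  refine Real.log_le_log (by positivity) ?_
  cases v with
  | anytime => simpa [UCBVersion.level] using ht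
  | fixedHorizon =>
    simp only [UCBVersion.level, one_div_one_div]
    nlinarith

/-- The good event for a reward table `y` with mean rewards `μ`: no arm is unlucky by more than
`1 - κ` bonuses during its first `m` pulls, and no arm is ever lucky by more than two bonuses. -/
structure HasModerateDeviations (μ : K → ℝ) (κ : ℝ) (m T : ℕ) (y : K → ℕ → ℝ) : Prop where
  lower : ∀ a, ∀ n ∈ Finset.Icc 1 m,
    -((1 - κ) * minBonus T * √n) < ∑ i ∈ Finset.range n, (y a i - μ a)
  upper : ∀ a, ∀ n ∈ Finset.Icc 1 T,
    ∑ i ∈ Finset.range n, (y a i - μ a) < 2 * minBonus T * √n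

theorem sum_div_eq_add_sum_sub_div (x : ℕ → ℝ) (μ : ℝ) {n : ℕ} (hn : 0 < n) :
    (∑ i ∈ Finset.range n, x i) / (n : ℝ) = μ + (∑ i ∈ Finset.range n, (x i - μ)) / n := by
  have hn' : (n : ℝ) ≠ 0 := by positivity
  rw [Finset.sum_sub_distrib, Finset.sum_const, Finset.card_range, nsmul_eq_mul]
  field_simp
  ring

theorem mul_sqrt_div_eq_div_sqrt (c n : ℝ) : c * √n / n = c / √n := by
  rw [mul_div_assoc, Real.sqrt_div_self', mul_one_div]

variable {μ : K → ℝ} {κ D r : ℝ} {m t : ℕ}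

theorem HasModerateDeviations.lt_empMean_add (hy : HasModerateDeviations μ κ m T y) {b : K}
    (hκ : κ ≤ 1) (hr : minBonus T ≤ r) (hμ : 0 ≤ μ b) (hb : pulls A t b ∈ Finset.Icc 1 m) :
    κ * r / √(pulls A t b) < empMean y A t b + r / √(pulls A t b) := by
  have hpos : 0 < pulls A t b := (Finset.mem_Icc.1 hb).1
  set n := pulls A t b
  have hdev : -((1 - κ) * minBonus T) / √n < (∑ i ∈ Finset.range n, (y b i - μ b)) / n := by
    rw [← mul_sqrt_div_eq_div_sqrt, neg_mul]
    gcongr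
    exact hy.lower b _ hb
  have hbonus : -((1 - κ) * r) / √n ≤ -((1 - κ) * minBonus T) / √n := by
    have : 0 ≤ 1 - κ := by linarith
    gcongr
  rw [empMean, sum_div_eq_add_sum_sub_div _ (μ b) hpos]
  have hsplit : κ * r / √n = -((1 - κ) * r) / √n + r / √n := by ring
  linarith

theorem HasModerateDeviations.empMean_add_lt (hy : HasModerateDeviations μ κ m T y) {a : K}
    (hr : minBonus T ≤ r) (hμ : μ a ≤ D) (ha : pulls A t a ∈ Finset.Icc 1 T) :
    empMean y A t a + r / √(pulls A t a) < D + 3 * r / √(pulls A t a) := by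
  have hpos : 0 < pulls A t a := (Finset.mem_Icc.1 ha).1
  set n := pulls A t a
  have hdev : (∑ i ∈ Finset.range n, (y a i - μ a)) / n < 2 * minBonus T / √n := by
    rw [← mul_sqrt_div_eq_div_sqrt]
    gcongr
    exact hy.upper a _ ha
  have hbonus : 2 * minBonus T / √n ≤ 2 * r / √n := by gcongr
  rw [empMean, sum_div_eq_add_sum_sub_div _ (μ a) hpos]
  have hsplit : 3 * r / √n = 2 * r / √n + r / √n := by ring
  linarith

theorem sq_mul_lt_of_mul_div_sqrt_lt {n q : ℝ} (hκ : 0 ≤ κ) (hr : 0 ≤ r) (hn : 0 < n)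
    (hq : 0 < q) (h : κ * r / √n < 4 * r / √q) : κ ^ 2 * q < 16 * n := by
  rw [div_lt_div_iff₀ (by positivity) (by positivity)] at h
  have hsqrt : κ * √q < 4 * √n := lt_of_mul_lt_mul_left (by linarith) hr
  have hsq := pow_lt_pow_left₀ hsqrt (by positivity) two_ne_zero
  rw [mul_pow, mul_pow, Real.sq_sqrt hq.le, Real.sq_sqrt hn.le] at hsq
  linarith

theorem IsUCBRun.lt_pulls [Fintype K] (hrun : IsUCBRun v T y A)
    (hy : HasModerateDeviations μ κ m T y) (hκ₀ : 0 ≤ κ) (hκ₁ : κ ≤ 1) {q : ℕ} (hq : 0 < q)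
    (hT : 2 * (Fintype.card K * q) + 1 < T) (hD : D * √q ≤ minBonus T)
    (hm : 16 * (m : ℝ) ≤ κ ^ 2 * q) (hμ₀ : ∀ a, 0 ≤ μ a) (hμD : ∀ a, μ a ≤ D) (b : K) :
    m < pulls A T b := by
  by_contra! hb
  obtain ⟨t, hst, htT, hqt⟩ := exists_le_pulls_of_card_mul_lt A (T := T) (s := (T + 1) / 2)
    (fun t _ _ => Finset.mem_univ (A t)) (show Finset.univ.card * q < T - (T + 1) / 2 by
      rw [Finset.card_univ]; omega)
  have hhalf : (T : ℝ) / 2 ≤ t := by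
    have : (T : ℝ) ≤ 2 * t := by exact_mod_cast (by omega : T ≤ 2 * t)
    linarith
  have hpos : 0 < pulls A t (A t) := hq.trans_le hqt
  have hpos' : 0 < pulls A t b := hrun.pulls_pos_of_pulls_self_pos htT hpos b
  have hle : pulls A t b ≤ m := (pulls_mono A b htT.le).trans hb
  have hindex := hrun t htT b
  rw [ucbIndex_of_pulls_pos _ hpos, ucbIndex_of_pulls_pos _ hpos', EReal.coe_le_coe_iff,
    Real.sqrt_div' _ (Nat.cast_nonneg _), Real.sqrt_div' _ (Nat.cast_nonneg _)] at hindex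
  have hr := minBonus_le_sqrt_two_mul_log_level v (by omega) hhalf
  set r := √(2 * Real.log (1 / v.level T t))
  have hchain : κ * r / √(pulls A t b) < 4 * r / √q := by
    calc κ * r / √(pulls A t b)
        < empMean y A t b + r / √(pulls A t b) :=
          hy.lt_empMean_add hκ₁ hr (hμ₀ b) (Finset.mem_Icc.2 ⟨hpos', hle⟩)
      _ ≤ empMean y A t (A t) + r / √(pulls A t (A t)) := hindex
      _ < D + 3 * r / √(pulls A t (A t)) :=
          hy.empMean_add_lt hr (hμD _) (Finset.mem_Icc.2 ⟨hpos, (pulls_le A t _).trans htT.le⟩)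
      _ ≤ r / √q + 3 * r / √q := by
          gcongr
          exact (le_div_iff₀ (by positivity)).2 (hD.trans hr)
      _ = 4 * r / √q := by ring
  have hsq := sq_mul_lt_of_mul_div_sqrt_lt hκ₀ (Real.sqrt_nonneg _) (Nat.cast_pos.2 hpos')
    (Nat.cast_pos.2 hq) hchain
  have hle' : (pulls A t b : ℝ) ≤ m := by exact_mod_cast hle
  linarith

end UCB
section Concentration

variable {K Ω : Type*} [MeasurableSpace Ω] {P : Measure Ω} {c : NNReal}

theorem measureReal_mul_sqrt_le_sum_range_le {X : ℕ → Ω → ℝ} (hind : iIndepFun X P)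
    (hX : ∀ i, HasSubgaussianMGF (X i) c P) {x : ℝ} (hx : 0 ≤ x) {n : ℕ} (hn : 0 < n) :
    P.real {ω | x * √n ≤ ∑ i ∈ Finset.range n, X i ω} ≤ Real.exp (-x ^ 2 / (2 * c)) := by
  refine (HasSubgaussianMGF.measure_sum_range_ge_le_of_iIndepFun hind (fun i _ => hX i)
    (by positivity)).trans_eq ?_
  rw [mul_pow, Real.sq_sqrt (Nat.cast_nonneg _)]
  congr 1
  field_simp

theorem measureReal_exists_mul_sqrt_le_sum_range_le [Fintype K] {X : K → ℕ → Ω → ℝ}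
    (hind : ∀ a, iIndepFun (X a) P) (hX : ∀ a i, HasSubgaussianMGF (X a i) c P) {x : ℝ}
    (hx : 0 ≤ x) (m : ℕ) :
    P.real {ω | ∃ a, ∃ n ∈ Finset.Icc 1 m, x * √n ≤ ∑ i ∈ Finset.range n, X a i ω} ≤
      Fintype.card K * (m * Real.exp (-x ^ 2 / (2 * c))) := by
  have hunion : {ω | ∃ a, ∃ n ∈ Finset.Icc 1 m, x * √n ≤ ∑ i ∈ Finset.range n, X a i ω} =
      ⋃ i ∈ (Finset.univ : Finset K) ×ˢ Finset.Icc 1 m,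
        {ω | x * √i.2 ≤ ∑ j ∈ Finset.range i.2, X i.1 j ω} := by
    ext ω
    simp
  rw [hunion]
  calc _ ≤ ∑ i ∈ (Finset.univ : Finset K) ×ˢ Finset.Icc 1 m,
        P.real {ω | x * √i.2 ≤ ∑ j ∈ Finset.range i.2, X i.1 j ω} :=
        measureReal_biUnion_finset_le _ _
    _ ≤ ∑ _i ∈ (Finset.univ : Finset K) ×ˢ Finset.Icc 1 m, Real.exp (-x ^ 2 / (2 * c)) :=
        Finset.sum_le_sum fun i hi => measureReal_mul_sqrt_le_sum_range_le (hind i.1) (hX i.1) hx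
          (Finset.mem_Icc.1 (Finset.mem_product.1 hi).2).1
    _ = Fintype.card K * (m * Real.exp (-x ^ 2 / (2 * c))) := by simp [mul_assoc]

variable {law : K → Measure ℝ} {Y : K → ℕ → Ω → ℝ} {μ : K → ℝ}

theorem IsRewardTable.iIndepFun_arm (hY : IsRewardTable P law Y) (a : K) :
    iIndepFun (Y a) P :=
  hY.indep.precomp (g := fun n => (a, n)) fun _ _ h => (Prod.mk.inj h).2

theorem IsRewardTable.hasSubgaussianMGF_sub (hY : IsRewardTable P law Y)
    (hlaw : ∀ a, HasSubgaussianMGF (fun y => y - μ a) c (law a)) (a : K) (n : ℕ) :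
    HasSubgaussianMGF (fun ω => Y a n ω - μ a) c P := by
  have h := hlaw a
  rw [← hY.map_eq a n] at h
  exact h.of_map (hY.measurable a n).aemeasurable

variable [IsFiniteMeasure P] [Fintype K]

theorem IsRewardTable.measureReal_not_hasModerateDeviations_le (hY : IsRewardTable P law Y)
    (hlaw : ∀ a, HasSubgaussianMGF (fun y => y - μ a) c (law a)) {κ : ℝ} (hκ : κ ≤ 1) (m T : ℕ) :
    P.real {ω | ¬ HasModerateDeviations μ κ m T fun a n => Y a n ω} ≤
      Fintype.card K * (m * Real.exp (-((1 - κ) * minBonus T) ^ 2 / (2 * c))) +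
        Fintype.card K * (T * Real.exp (-(2 * minBonus T) ^ 2 / (2 * c))) := by
  have hbonus : 0 ≤ minBonus T := Real.sqrt_nonneg _
  have hlower := measureReal_exists_mul_sqrt_le_sum_range_le
    (X := fun a i ω => -(Y a i ω - μ a)) (c := c)
    (fun a => (hY.iIndepFun_arm a).comp (fun _ y => -(y - μ a)) fun _ => by fun_prop)
    (fun a i => (hY.hasSubgaussianMGF_sub hlaw a i).neg)
    (mul_nonneg (sub_nonneg.2 hκ) hbonus) m
  have hupper := measureReal_exists_mul_sqrt_le_sum_range_le (X := fun a i ω => Y a i ω - μ a)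
    (fun a => (hY.iIndepFun_arm a).comp (fun _ y => y - μ a) fun _ => by fun_prop)
    (hY.hasSubgaussianMGF_sub hlaw) (mul_nonneg zero_le_two hbonus) T
  refine (measureReal_mono fun ω hω => ?_).trans
    ((measureReal_union_le _ _).trans (add_le_add hlower hupper))
  by_contra hgood
  simp only [Set.mem_union, Set.mem_ofPred_eq, not_or, not_exists, not_and, not_le,
    Finset.sum_neg_distrib] at hgood
  exact hω ⟨fun a n hn => neg_lt.1 (hgood.1 a n hn), hgood.2⟩

theorem exp_neg_sq_mul_minBonus {T : ℕ} (hT : 2 ≤ T) (x c : ℝ) :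
    Real.exp (-(x * minBonus T) ^ 2 / (2 * c)) = ((T : ℝ) / 2) ^ (-(x ^ 2 / c)) := by
  have hT' : (1 : ℝ) ≤ T / 2 := by
    have : (2 : ℝ) ≤ T := by exact_mod_cast hT
    linarith
  rw [mul_pow, minBonus, Real.sq_sqrt (mul_nonneg zero_le_two (Real.log_nonneg hT')),
    Real.rpow_def_of_pos (by positivity)]
  congr 1
  ring

end Concentration

section LongHorizon

variable {ε c k : ℝ} {T : ℕ}

theorem rpow_one_sub_mul_sq_rpow_half (hT : 0 < T) (ε : ℝ) :
    (T : ℝ) ^ (1 - ε) * ((T : ℝ) ^ (ε / 2)) ^ 2 = T := by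
  have hT' : (0 : ℝ) < T := Nat.cast_pos.2 hT
  rw [← Real.rpow_mul_natCast hT'.le, ← Real.rpow_add hT']
  ring_nf
  exact Real.rpow_one _

theorem rpow_mul_half_rpow_le (hε₀ : 0 ≤ ε) (hε₁ : ε ≤ 2) (hc₀ : 0 < c) (hc : c ≤ 1 + ε / 6)
    (hT : 2 ≤ T) (hTε : 8 ≤ (T : ℝ) ^ (ε / 2)) :
    (T : ℝ) ^ (1 - ε) * ((T : ℝ) / 2) ^ (-((1 - ε / 6) ^ 2 / c)) ≤ 1 / 4 := by
  have hT' : (2 : ℝ) ≤ T := by exact_mod_cast hT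
  have hexponent : 1 - ε / 2 ≤ (1 - ε / 6) ^ 2 / c := by
    rw [le_div_iff₀ hc₀]
    nlinarith
  have htwo : (2 : ℝ) ^ (1 - ε / 2) ≤ 2 :=
    (Real.rpow_le_rpow_of_exponent_le one_le_two (by linarith)).trans_eq (Real.rpow_one 2)
  calc (T : ℝ) ^ (1 - ε) * ((T : ℝ) / 2) ^ (-((1 - ε / 6) ^ 2 / c))
      ≤ (T : ℝ) ^ (1 - ε) * ((T : ℝ) / 2) ^ (-(1 - ε / 2)) := by
        gcongr
        linarith
    _ = 2 ^ (1 - ε / 2) * ((T : ℝ) ^ (1 - ε) * (T : ℝ) ^ (-(1 - ε / 2))) := by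
        rw [Real.div_rpow (by positivity) zero_le_two, Real.rpow_neg zero_le_two, div_inv_eq_mul]
        ring
    _ = 2 ^ (1 - ε / 2) / (T : ℝ) ^ (ε / 2) := by
        rw [← Real.rpow_add (by positivity), show 1 - ε + -(1 - ε / 2) = -(ε / 2) by ring,
          Real.rpow_neg (by positivity), ← div_eq_mul_inv]
    _ ≤ 2 / 8 := by gcongr
    _ = 1 / 4 := by norm_num

theorem mul_half_rpow_le (hc₀ : 0 < c) (hc : 3 * c ≤ 4) (hk : k ≤ T) (hT : 32 ≤ T) :
    k * (T * ((T : ℝ) / 2) ^ (-(2 ^ 2 / c))) ≤ 1 / 4 := by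
  have hT' : (32 : ℝ) ≤ T := by exact_mod_cast hT
  have hexponent : 3 ≤ 2 ^ 2 / c := by
    rw [le_div_iff₀ hc₀]
    linarith
  calc k * (T * ((T : ℝ) / 2) ^ (-(2 ^ 2 / c)))
      ≤ T * (T * ((T : ℝ) / 2) ^ (-3 : ℝ)) := by
        gcongr
        linarith
    _ = 8 / T := by
        rw [Real.rpow_neg (by positivity), show (3 : ℝ) = (3 : ℕ) by norm_num, Real.rpow_natCast]
        field_simp
        norm_num
    _ ≤ 1 / 4 := by
        rw [div_le_iff₀ (by positivity)]
        linarith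

theorem one_le_minBonus (hT : 4 ≤ T) : 1 ≤ minBonus T := by
  have hT' : (2 : ℝ) ≤ T / 2 := by
    have : (4 : ℝ) ≤ T := by exact_mod_cast hT
    linarith
  have hlog : Real.log 2 ≤ Real.log ((T : ℝ) / 2) := Real.log_le_log two_pos hT'
  exact Real.one_le_sqrt.2 (by linarith [Real.log_two_gt_d9])

/-- The horizon `T` is long for `k` arms and the loss `ε` in the exponent of the regret: powers of
`T` absorb the constants of the underexploration argument, which are collected in `1 + 48 / ε`. -/
structure IsLongHorizon (ε k : ℝ) (T : ℕ) : Prop where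
  loss_pos : 0 < ε
  loss_le_one : ε ≤ 1
  le_rpow_half : 1 + 48 / ε ≤ (T : ℝ) ^ (ε / 2)
  le_rpow_one_sub : k ≤ (T : ℝ) ^ (1 - ε)

theorem IsLongHorizon.const_le_rpow_half (h : IsLongHorizon ε k T) : 49 ≤ (T : ℝ) ^ (ε / 2) := by
  have : 48 ≤ 48 / ε := le_div_self (by norm_num) h.loss_pos h.loss_le_one
  linarith [h.le_rpow_half]

theorem IsLongHorizon.horizon_pos (h : IsLongHorizon ε k T) : 0 < T := by
  by_contra! hT
  have hε := h.loss_pos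
  have h49 := h.const_le_rpow_half
  rw [Nat.le_zero.1 hT, Nat.cast_zero, Real.zero_rpow (by positivity)] at h49
  norm_num at h49

theorem IsLongHorizon.mul_le_horizon (h : IsLongHorizon ε k T) : 2401 * k ≤ T := by
  rw [← rpow_one_sub_mul_sq_rpow_half h.horizon_pos ε]
  have := h.const_le_rpow_half
  calc 2401 * k ≤ 2401 * (T : ℝ) ^ (1 - ε) := by gcongr; exact h.le_rpow_one_sub
    _ = (T : ℝ) ^ (1 - ε) * 49 ^ 2 := by ring
    _ ≤ _ := by gcongr

theorem IsLongHorizon.mul_rpow_le_sq_mul_horizon (h : IsLongHorizon ε k T) :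
    2304 * (T : ℝ) ^ (1 - ε) ≤ ε ^ 2 * T := by
  nth_rw 2 [← rpow_one_sub_mul_sq_rpow_half h.horizon_pos ε]
  have h48 : 48 ≤ ε * (T : ℝ) ^ (ε / 2) := by
    rw [← div_le_iff₀' h.loss_pos]
    linarith [h.le_rpow_half]
  calc 2304 * (T : ℝ) ^ (1 - ε) = (T : ℝ) ^ (1 - ε) * 48 ^ 2 := by ring
    _ ≤ (T : ℝ) ^ (1 - ε) * (ε * (T : ℝ) ^ (ε / 2)) ^ 2 := by gcongr
    _ = _ := by ring

variable {K Ω : Type*} [Fintype K] [MeasurableSpace Ω] {P : Measure Ω} {law : K → Measure ℝ}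
  {Y : K → ℕ → Ω → ℝ} {μ : K → ℝ} {σ : NNReal}

theorem IsRewardTable.measureReal_not_hasModerateDeviations_le_half [IsFiniteMeasure P] [Nonempty K]
    (hY : IsRewardTable P law Y) (hlaw : ∀ a, HasSubgaussianMGF (fun y => y - μ a) σ (law a))
    (hσ₀ : 0 < σ) (hσ : σ ≤ 1 + ε / 6) (hlong : IsLongHorizon ε (Fintype.card K) T) :
    P.real {ω | ¬ HasModerateDeviations μ (ε / 6) ⌊(T : ℝ) ^ (1 - ε) / Fintype.card K⌋₊ T
      fun a n => Y a n ω} ≤ 1 / 2 := by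
  have hε₀ := hlong.loss_pos
  have hε₁ := hlong.loss_le_one
  have hk : (1 : ℝ) ≤ Fintype.card K := by exact_mod_cast Fintype.card_pos
  have hKT := hlong.mul_le_horizon
  have hT : 32 ≤ T := by
    have : (32 : ℝ) ≤ T := by linarith
    exact_mod_cast this
  have hσ₀' : (0 : ℝ) < σ := by exact_mod_cast hσ₀
  have hunion := hY.measureReal_not_hasModerateDeviations_le hlaw (κ := ε / 6) (by linarith)
    ⌊(T : ℝ) ^ (1 - ε) / Fintype.card K⌋₊ T
  rw [exp_neg_sq_mul_minBonus (by omega), exp_neg_sq_mul_minBonus (by omega)] at hunion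
  set k := (Fintype.card K : ℝ)
  set x := ((T : ℝ) / 2) ^ (-((1 - ε / 6) ^ 2 / (σ : ℝ)))
  have hlower : k * (⌊(T : ℝ) ^ (1 - ε) / k⌋₊ * x) ≤ 1 / 4 := by
    calc k * (⌊(T : ℝ) ^ (1 - ε) / k⌋₊ * x) ≤ k * ((T : ℝ) ^ (1 - ε) / k * x) := by
          gcongr
          exact Nat.floor_le (by positivity)
      _ = (T : ℝ) ^ (1 - ε) * x := by field_simp
      _ ≤ 1 / 4 := rpow_mul_half_rpow_le hε₀.le (by linarith) hσ₀' hσ (by omega)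
          (by linarith [hlong.const_le_rpow_half])
  have hupper := mul_half_rpow_le (k := k) hσ₀' (by linarith) (by linarith) hT
  linarith

theorem mul_sqrt_le_one {D q k t : ℝ} (hq : 0 ≤ q) (ht : 0 < t) (hD : D ^ 2 * t ≤ k)
    (hkq : k * q ≤ t) : D * √q ≤ 1 := by
  refine (abs_le.1 ((sq_le_one_iff_abs_le_one _).1 ?_)).2
  rw [mul_pow, Real.sq_sqrt hq]
  refine le_of_mul_le_mul_right ?_ ht
  calc D ^ 2 * q * t = D ^ 2 * t * q := by ring
    _ ≤ k * q := by gcongr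
    _ ≤ 1 * t := by rwa [one_mul]

variable [DecidableEq K] {v : UCBVersion} {D : ℝ} {A : ℕ → Ω → K}

theorem IsUCBRun.rpow_div_card_lt_pulls {y : K → ℕ → ℝ} {A : ℕ → K} (hrun : IsUCBRun v T y A)
    (hlong : IsLongHorizon ε (Fintype.card K) T)
    (hD : D ^ 2 * T ≤ Fintype.card K) (hμ₀ : ∀ a, 0 ≤ μ a) (hμD : ∀ a, μ a ≤ D)
    (hy : HasModerateDeviations μ (ε / 6) ⌊(T : ℝ) ^ (1 - ε) / Fintype.card K⌋₊ T y) (b : K) :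
    (T : ℝ) ^ (1 - ε) / Fintype.card K < pulls A T b := by
  have hε₀ := hlong.loss_pos
  have hε₁ := hlong.loss_le_one
  have hK : 0 < Fintype.card K := Fintype.card_pos_iff.2 ⟨b⟩
  have hTpos : (0 : ℝ) < T := Nat.cast_pos.2 (hlong.horizon_pos)
  have hKT := hlong.mul_le_horizon
  have hTε := hlong.mul_rpow_le_sq_mul_horizon
  set k := Fintype.card K
  have hk : (1 : ℝ) ≤ k := by exact_mod_cast hK
  -- The arm that beats `b` late in the run has been pulled at least `T / (4 k)` times.
  set q := ⌈(T : ℝ) / (4 * k)⌉₊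
  have hqle : (T : ℝ) / (4 * k) ≤ q := Nat.le_ceil _
  have hqlt : (k : ℝ) * q < T / 4 + k := by
    calc (k : ℝ) * q < k * (T / (4 * k) + 1) := by
          gcongr
          exact Nat.ceil_lt_add_one (by positivity)
      _ = T / 4 + k := by field_simp
  refine (Nat.floor_lt (by positivity)).1
    (hrun.lt_pulls hy (by positivity) (by linarith) (q := q) (Nat.ceil_pos.2 (by positivity))
      ?_ ?_ ?_ hμ₀ hμD b)
  · have : (2 * (k * q) + 1 : ℝ) < T := by linarith
    exact_mod_cast this
  · have hT : 4 ≤ T := by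
      have : (4 : ℝ) ≤ T := by linarith
      exact_mod_cast this
    refine le_trans ?_ (one_le_minBonus hT)
    exact mul_sqrt_le_one (by positivity) hTpos hD (by linarith)
  · calc 16 * (⌊(T : ℝ) ^ (1 - ε) / k⌋₊ : ℝ) ≤ 16 * ((T : ℝ) ^ (1 - ε) / k) := by
          gcongr
          exact Nat.floor_le (by positivity)
      _ = 2304 * (T : ℝ) ^ (1 - ε) / (144 * k) := by ring
      _ ≤ ε ^ 2 * T / (144 * k) := by gcongr
      _ = (ε / 6) ^ 2 * (T / (4 * k)) := by ring
      _ ≤ (ε / 6) ^ 2 * q := by gcongr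

theorem half_le_measureReal_rpow_div_card_lt_pulls [IsProbabilityMeasure P]
    (hY : IsRewardTable P law Y) (hlaw : ∀ a, HasSubgaussianMGF (fun y => y - μ a) σ (law a))
    (hμ₀ : ∀ a, 0 ≤ μ a) (hμD : ∀ a, μ a ≤ D)
    (hrun : ∀ᵐ ω ∂P, IsUCBRun v T (fun a n => Y a n ω) fun t => A t ω)
    (hσ₀ : 0 < σ) (hσ : σ ≤ 1 + ε / 6)
    (hlong : IsLongHorizon ε (Fintype.card K) T) (hD : D ^ 2 * T ≤ Fintype.card K) (b : K) :
    1 / 2 ≤ P.real {ω | (T : ℝ) ^ (1 - ε) / Fintype.card K < pulls (fun t => A t ω) T b} := by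
  have : Nonempty K := ⟨b⟩
  set Bad := {ω | ¬ HasModerateDeviations μ (ε / 6) ⌊(T : ℝ) ^ (1 - ε) / Fintype.card K⌋₊ T
    fun a n => Y a n ω}
  set Pulled := {ω | (T : ℝ) ^ (1 - ε) / Fintype.card K < pulls (fun t => A t ω) T b}
  have hcover : (Set.univ : Set Ω) ≤ᵐ[P] (Pulled ∪ Bad : Set Ω) := by
    filter_upwards [hrun] with ω hω _
    exact (or_not_of_imp fun hgood =>
      hω.rpow_div_card_lt_pulls hlong hD hμ₀ hμD hgood b)
  have hbad : P.real Bad ≤ 1 / 2 :=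
    hY.measureReal_not_hasModerateDeviations_le_half hlaw hσ₀ hσ hlong
  have hone : 1 ≤ P.real (Pulled ∪ Bad) := by
    rw [← probReal_univ (μ := P)]
    exact ENNReal.toReal_mono (measure_ne_top _ _) (measure_mono_ae hcover)
  linarith [measureReal_union_le (μ := P) Pulled Bad]

end LongHorizon

section Regret

variable {K Ω : Type*} [Finite K] [MeasurableSpace Ω] {P : Measure Ω} [IsFiniteMeasure P]

theorem integrable_comp_of_finite {B : Ω → K} (hB : ∀ a, MeasurableSet (B ⁻¹' {a})) (f : K → ℝ) :
    Integrable (fun ω => f (B ω)) P := by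
  let _ : MeasurableSpace K := ⊤
  have hmeas : Measurable fun ω => f (B ω) :=
    (measurable_of_finite f).comp (measurable_to_countable' hB)
  obtain ⟨C, hC⟩ := (Set.finite_range fun a => ‖f a‖).bddAbove
  exact .of_bound hmeas.aestronglyMeasurable C (.of_forall fun ω => hC ⟨B ω, rfl⟩)

variable [DecidableEq K] {A : ℕ → Ω → K}

theorem integrable_pulls (hA : ∀ t a, MeasurableSet (A t ⁻¹' {a})) (T : ℕ) (a : K) :
    Integrable (fun ω => (pulls (fun t => A t ω) T a : ℝ)) P := by
  simp only [pulls, Finset.card_filter, Nat.cast_sum]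
  exact integrable_finsetSum _ fun t _ =>
    integrable_comp_of_finite (hA t) fun b => ((if b = a then 1 else 0 : ℕ) : ℝ)

theorem mul_le_integral_pulls (hA : ∀ t a, MeasurableSet (A t ⁻¹' {a})) {T : ℕ} {a : K}
    {q x : ℝ} (hx : 0 ≤ x) (h : q ≤ P.real {ω | x ≤ pulls (fun t => A t ω) T a}) :
    q * x ≤ ∫ ω, (pulls (fun t => A t ω) T a : ℝ) ∂P := by
  calc q * x ≤ x * P.real {ω | x ≤ pulls (fun t => A t ω) T a} := by
        rw [mul_comm]; gcongr
    _ ≤ _ := mul_meas_ge_le_integral_of_nonneg (.of_forall fun _ => Nat.cast_nonneg _)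
        (integrable_pulls hA T a) x

theorem expectedRegret_eq_sum_mul_integral_pulls [Fintype K] [IsProbabilityMeasure P]
    (hA : ∀ t a, MeasurableSet (A t ⁻¹' {a})) (mean : K → ℝ) (T : ℕ) :
    expectedRegret P mean A T =
      ∑ a, ((⨆ b, mean b) - mean a) * ∫ ω, (pulls (fun t => A t ω) T a : ℝ) ∂P := by
  calc expectedRegret P mean A T
      = ∫ ω, ∑ t ∈ Finset.range T, ((⨆ b, mean b) - mean (A t ω)) ∂P := by
        rw [integral_finsetSum _ fun t _ =>
          integrable_comp_of_finite (hA t) fun a => (⨆ b, mean b) - mean a]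
        simp_rw [integral_sub (integrable_const _) (integrable_comp_of_finite (hA _) mean)]
        simp [expectedRegret]
    _ = ∫ ω, ∑ a, pulls (fun t => A t ω) T a * ((⨆ b, mean b) - mean a) ∂P := by
        congr with ω
        exact sum_range_comp_eq_sum_pulls_mul (fun t => A t ω) T fun a => (⨆ b, mean b) - mean a
    _ = _ := by
        rw [integral_finsetSum _ fun a _ => (integrable_pulls hA T a).mul_const _]
        simp_rw [integral_mul_const, mul_comm]

theorem mul_card_mul_le_expectedRegret [IsProbabilityMeasure P]
    (hA : ∀ t a, MeasurableSet (A t ⁻¹' {a})) {mean : K → ℝ} {T : ℕ} {S : Finset K} {Δ x : ℝ}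
    (hΔ : 0 ≤ Δ) (hgap : ∀ a ∈ S, Δ ≤ (⨆ b, mean b) - mean a)
    (hpulls : ∀ a ∈ S, x ≤ ∫ ω, (pulls (fun t => A t ω) T a : ℝ) ∂P) :
    Δ * (S.card * x) ≤ expectedRegret P mean A T := by
  cases nonempty_fintype K
  have hnonneg : ∀ a, 0 ≤ ∫ ω, (pulls (fun t => A t ω) T a : ℝ) ∂P := fun a =>
    integral_nonneg fun ω => Nat.cast_nonneg _
  rw [expectedRegret_eq_sum_mul_integral_pulls hA]
  calc Δ * (S.card * x) = ∑ _a ∈ S, Δ * x := by simp; ring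
    _ ≤ ∑ a ∈ S, ((⨆ b, mean b) - mean a) * ∫ ω, (pulls (fun t => A t ω) T a : ℝ) ∂P :=
        Finset.sum_le_sum fun a ha => (mul_le_mul_of_nonneg_left (hpulls a ha) hΔ).trans
          (mul_le_mul_of_nonneg_right (hgap a ha) (hnonneg a))
    _ ≤ _ := Finset.sum_le_univ_sum_of_nonneg fun a => mul_nonneg
        (sub_nonneg.2 (le_ciSup (Set.finite_range mean).bddAbove a)) (hnonneg a)

end Regret

section RewardLaw

instance isProbabilityMeasure_marginal (q : unitInterval) :
    IsProbabilityMeasure (marginal q) := by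
  constructor
  simp only [marginal, Measure.add_apply, Measure.smul_apply, measure_univ, smul_eq_mul, mul_one]
  rw [← ENNReal.ofReal_add q.2.1 (sub_nonneg.2 q.2.2), add_sub_cancel, ENNReal.ofReal_one]

instance isProbabilityMeasure_coordLaw (q : unitInterval) (o : Option (Fin 2)) :
    IsProbabilityMeasure (coordLaw q o) := by
  cases o <;> (simp only [coordLaw]; infer_instance)

theorem value_mem_Icc (v : Fin 2) : value v ∈ Set.Icc 1 2 := by
  fin_cases v <;> norm_num [value]

theorem hasSubgaussianMGF_id_gaussianReal (v : NNReal) :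
    HasSubgaussianMGF id v (gaussianReal 0 v) where
  integrable_exp_mul := integrable_exp_mul_gaussianReal
  mgf_le t := by simp [mgf_id_gaussianReal]

theorem hasSubgaussianMGF_mul_value_sub (Δ : ℝ) (ν : Measure (Fin 2)) [IsProbabilityMeasure ν] :
    HasSubgaussianMGF (fun x => Δ * (value x - ∫ x, value x ∂ν)) ((‖Δ‖₊ / 2) ^ 2) ν := by
  have h := (hasSubgaussianMGF_of_mem_Icc (μ := ν) (measurable_of_finite value).aemeasurable
    (.of_forall value_mem_Icc)).const_mul Δ
  convert! h using 1
  refine NNReal.eq (show (‖Δ‖ / 2) ^ 2 = Δ ^ 2 * (‖(2 : ℝ) - 1‖ / 2) ^ 2 from ?_)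
  norm_num [div_pow, div_eq_mul_inv, mul_pow]

variable {N : ℕ} [NeZero N] (Δ : ℝ) (p : Fin N → unitInterval) (a : Intervention N)

theorem rewardLaw_eq_map_coordLaw_prod :
    rewardLaw Δ p a =
      ((coordLaw (p 0) (a 0)).prod (gaussianReal 0 1)).map fun z => Δ * value z.1 + z.2 := by
  have heval := (measurePreserving_eval (fun i => coordLaw (p i) (a i)) 0).prod
    (MeasurePreserving.id (gaussianReal 0 1))
  rw [← heval.map_eq, Measure.map_map (by fun_prop) heval.measurable]
  rfl

theorem armMean_eq_mul_integral_value :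
    armMean Δ p a = Δ * ∫ x, value x ∂coordLaw (p 0) (a 0) := by
  have hvalue : Integrable value (coordLaw (p 0) (a 0)) := .of_finite
  have hnoise : Integrable (fun y => y) (gaussianReal 0 1) :=
    (hasSubgaussianMGF_id_gaussianReal 1).integrable
  rw [armMean, rewardLaw_eq_map_coordLaw_prod, integral_map (by fun_prop) (by fun_prop),
    integral_add ((hvalue.const_mul Δ).comp_fst _) (hnoise.comp_snd _),
    integral_fun_fst fun x => Δ * value x, integral_fun_snd fun y : ℝ => y]
  simp [integral_const_mul]

theorem armMean_of_eq_some {v : Fin 2} (h : a 0 = some v) : armMean Δ p a = Δ * value v := by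
  rw [armMean_eq_mul_integral_value, h, coordLaw, integral_dirac]

variable {Δ}

theorem armMean_mem_Icc (hΔ : 0 ≤ Δ) : armMean Δ p a ∈ Set.Icc 0 (2 * Δ) := by
  have hint : ∫ x, value x ∂coordLaw (p 0) (a 0) ∈ Set.Icc 1 2 :=
    (convex_Icc 1 2).integral_mem isClosed_Icc (.of_forall value_mem_Icc) .of_finite
  rw [armMean_eq_mul_integral_value]
  constructor <;> nlinarith [hint.1, hint.2]

theorem iSup_armMean (hΔ : 0 ≤ Δ) : ⨆ a, armMean Δ p a = 2 * Δ := by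
  refine IsLUB.ciSup_eq (IsGreatest.isLUB ⟨⟨fun _ => some 1, ?_⟩, ?_⟩)
  · rw [armMean_of_eq_some Δ p _ rfl]
    norm_num [value, mul_comm]
  · rintro _ ⟨a, rfl⟩
    exact (armMean_mem_Icc p a hΔ).2

theorem hasSubgaussianMGF_rewardLaw :
    HasSubgaussianMGF (fun y => y - armMean Δ p a) (1 + (‖Δ‖₊ / 2) ^ 2) (rewardLaw Δ p a) := by
  rw [rewardLaw_eq_map_coordLaw_prod, ← HasSubgaussianMGF.id_map_iff (by fun_prop),
    Measure.map_map (by fun_prop) (by fun_prop), HasSubgaussianMGF.id_map_iff (by fun_prop),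
    armMean_eq_mul_integral_value]
  set ν := coordLaw (p 0) (a 0)
  set x := fun v => Δ * (value v - ∫ x, value x ∂ν) with hx
  have hvalue : HasSubgaussianMGF (x ∘ Prod.fst) ((‖Δ‖₊ / 2) ^ 2) (ν.prod (gaussianReal 0 1)) :=
    .of_map (by fun_prop) <| by
      simpa [Measure.map_fst_prod] using hasSubgaussianMGF_mul_value_sub Δ ν
  have hnoise : HasSubgaussianMGF (id ∘ Prod.snd) 1 (ν.prod (gaussianReal 0 1)) :=
    .of_map (by fun_prop) <| by
      simpa [Measure.map_snd_prod] using hasSubgaussianMGF_id_gaussianReal 1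
  have hindep : IndepFun (id ∘ Prod.snd) (x ∘ Prod.fst) (ν.prod (gaussianReal 0 1)) :=
    (indepFun_prod (X := x) (by fun_prop) measurable_id).symm
  convert! hnoise.add_of_indepFun hvalue hindep using 1
  ext z
  simp only [hx, Function.comp_apply, id]
  ring

end RewardLaw

section LowerBound

variable {N T : ℕ} {ε k : ℝ}

theorem three_mul_card_filter_apply_zero [NeZero N] (o : Option (Fin 2)) :
    3 * (Finset.univ.filter fun a : Intervention N => a 0 = o).card = 3 ^ N := by
  have h := Fintype.card_filter_piFinset_const_eq_of_mem Finset.univ (0 : Fin N)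
    (Finset.mem_univ o)
  rw [Fintype.piFinset_univ] at h
  rw [h]
  simp [mul_pow_sub_one (NeZero.ne N)]

/-- The effect `Δ` of `X₁` in the hard environment for horizon `T`: it is so small that `T / 3 ^ N`
pulls of an arm do not detect a difference of `2 Δ`. -/
noncomputable def hardGap (N T : ℕ) : ℝ := √(3 ^ N / T) / 2

/-- The factor by which `T ^ (1 - ε)` has to exceed the number of arms for `T` to be a long
horizon. -/
noncomputable def horizonThreshold (ε : ℝ) : ℝ := (1 + 48 / ε) ^ (2 / ε)

theorem hardGap_pos (hT : 0 < T) : 0 < hardGap N T := by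
  rw [hardGap]
  positivity

theorem two_mul_hardGap_le_one (hT : 3 ^ N ≤ T) : 2 * hardGap N T ≤ 1 := by
  have hT' : (3 : ℝ) ^ N ≤ T := by exact_mod_cast hT
  rw [hardGap, mul_div_cancel₀ _ two_ne_zero]
  exact Real.sqrt_le_one.2 (div_le_one_of_le₀ hT' (Nat.cast_nonneg _))

theorem sq_two_mul_hardGap_mul (hT : 0 < T) : (2 * hardGap N T) ^ 2 * T = 3 ^ N := by
  rw [hardGap, mul_div_cancel₀ _ two_ne_zero, Real.sq_sqrt (by positivity)]
  field_simp

theorem sqrt_mul_rpow_eq_two_mul_hardGap_mul_rpow (hT : 0 < T) (ε : ℝ) :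
    √(3 ^ N) * (T : ℝ) ^ (1 / 2 - ε) = 2 * hardGap N T * (T : ℝ) ^ (1 - ε) := by
  have hT' : (0 : ℝ) < T := Nat.cast_pos.2 hT
  rw [hardGap, mul_div_cancel₀ _ two_ne_zero, Real.sqrt_div (by positivity), div_mul_eq_mul_div,
    mul_div_assoc, Real.sqrt_eq_rpow (T : ℝ), ← Real.rpow_sub hT']
  ring_nf

theorem one_le_horizonThreshold (hε : 0 < ε) : 1 ≤ horizonThreshold ε :=
  Real.one_le_rpow (le_add_of_nonneg_right (by positivity)) (by positivity)

theorem isLongHorizon_of_horizonThreshold_mul_lt (hε : 0 < ε) (hk : 1 ≤ k) (hT : 1 ≤ T)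
    (h : horizonThreshold ε * k < (T : ℝ) ^ (1 - ε)) : IsLongHorizon ε k T := by
  have hT' : (1 : ℝ) ≤ T := by exact_mod_cast hT
  have hthreshold := one_le_horizonThreshold hε
  have hthreshold_lt : horizonThreshold ε < (T : ℝ) ^ (1 - ε) := by nlinarith
  refine ⟨hε, ?_, ?_, by nlinarith⟩
  · by_contra! hε₁
    linarith [Real.rpow_le_one_of_one_le_of_nonpos hT' (by linarith : 1 - ε ≤ 0)]
  · have hle : horizonThreshold ε ≤ T := hthreshold_lt.le.trans <|
      (Real.rpow_le_rpow_of_exponent_le hT' (by linarith)).trans_eq (Real.rpow_one _)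
    calc 1 + 48 / ε = horizonThreshold ε ^ (ε / 2) := by
          rw [horizonThreshold, ← Real.rpow_mul (by positivity), div_mul_div_cancel₀' two_ne_zero,
            div_self hε.ne', Real.rpow_one]
      _ ≤ (T : ℝ) ^ (ε / 2) := by gcongr

theorem IsLongHorizon.sq_half_hardGap_le (h : IsLongHorizon ε (3 ^ N) T) :
    (hardGap N T / 2) ^ 2 ≤ ε / 6 := by
  have hε₀ := h.loss_pos
  have hε₁ := h.loss_le_one
  have hT : (0 : ℝ) < T := Nat.cast_pos.2 h.horizon_pos
  have hscaled : (2 * hardGap N T) ^ 2 * T ≤ ε ^ 2 * T := by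
    rw [sq_two_mul_hardGap_mul h.horizon_pos]
    have : (0 : ℝ) ≤ 3 ^ N := by positivity
    linarith [h.mul_rpow_le_sq_mul_horizon, h.le_rpow_one_sub]
  have hsq := le_of_mul_le_mul_right hscaled hT
  nlinarith

variable [NeZero N] {Ω : Type*} [MeasurableSpace Ω] {P : Measure Ω} [IsProbabilityMeasure P]
  {p : Fin N → unitInterval} {v : UCBVersion} {Y : Intervention N → ℕ → Ω → ℝ}
  {A : ℕ → Ω → Intervention N}

theorem mul_pow_div_three_mul_le_expectedRegret {Δ x : ℝ} (hΔ : 0 ≤ Δ)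
    (hA : ∀ t a, MeasurableSet (A t ⁻¹' {a}))
    (hpulls : ∀ a, x ≤ ∫ ω, (pulls (fun t => A t ω) T a : ℝ) ∂P) :
    Δ * (3 ^ N / 3 * x) ≤ expectedRegret P (armMean Δ p) A T := by
  have hcard : (3 : ℝ) ^ N / 3 =
      (Finset.univ.filter fun a : Intervention N => a 0 = some 0).card := by
    rw [div_eq_iff three_ne_zero, mul_comm]
    exact_mod_cast (three_mul_card_filter_apply_zero (some 0)).symm
  rw [hcard]
  refine mul_card_mul_le_expectedRegret hA hΔ (fun a ha => ?_) fun a _ => hpulls a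
  rw [iSup_armMean p hΔ, armMean_of_eq_some Δ p a (Finset.mem_filter.1 ha).2]
  simp [value, two_mul]

theorem mul_pow_div_three_le_expectedRegret {Δ : ℝ} (hΔ : 0 ≤ Δ) (hT : 3 ^ N ≤ T)
    (hA : ∀ t a, MeasurableSet (A t ⁻¹' {a}))
    (hrun : ∀ᵐ ω ∂P, IsUCBRun v T (fun a n => Y a n ω) fun t => A t ω) :
    Δ * (3 ^ N / 3) ≤ expectedRegret P (armMean Δ p) A T := by
  rw [← mul_one (3 ^ N / 3 : ℝ)]
  refine mul_pow_div_three_mul_le_expectedRegret hΔ hA fun b => ?_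
  calc (1 : ℝ) = ∫ _, 1 ∂P := by simp
    _ ≤ ∫ ω, (pulls (fun t => A t ω) T b : ℝ) ∂P := by
      refine integral_mono_ae (integrable_const _) (integrable_pulls hA T b) ?_
      filter_upwards [hrun] with ω hω
      exact_mod_cast hω.pulls_pos_of_card_le (by simpa using hT) b

theorem hardGap_mul_rpow_div_six_le_expectedRegret (hlong : IsLongHorizon ε (3 ^ N) T)
    (hY : IsRewardTable P (rewardLaw (hardGap N T) p) Y)
    (hA : ∀ t a, MeasurableSet (A t ⁻¹' {a}))
    (hrun : ∀ᵐ ω ∂P, IsUCBRun v T (fun a n => Y a n ω) fun t => A t ω) :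
    hardGap N T * ((T : ℝ) ^ (1 - ε) / 6) ≤
      expectedRegret P (armMean (hardGap N T) p) A T := by
  have hgap := (hardGap_pos (N := N) hlong.horizon_pos).le
  have hcard : (Fintype.card (Intervention N) : ℝ) = 3 ^ N := by simp
  have hoften (b : Intervention N) :
      1 / 2 * ((T : ℝ) ^ (1 - ε) / 3 ^ N) ≤ ∫ ω, (pulls (fun t => A t ω) T b : ℝ) ∂P := by
    refine mul_le_integral_pulls hA (by positivity) ?_
    have h := half_le_measureReal_rpow_div_card_lt_pulls hY (hasSubgaussianMGF_rewardLaw p)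
      (fun a => (armMean_mem_Icc p a hgap).1) (fun a => (armMean_mem_Icc p a hgap).2) hrun
      (by positivity) (ε := ε) ?_ (by rwa [hcard])
      (by rw [hcard, sq_two_mul_hardGap_mul hlong.horizon_pos]) b
    · rw [hcard] at h
      exact h.trans (measureReal_mono (Set.ofPred_subset_ofPred.2 fun _ => le_of_lt))
    · simpa [div_pow] using hlong.sq_half_hardGap_le
  refine (mul_pow_div_three_mul_le_expectedRegret hgap hA hoften).trans' (le_of_eq ?_)
  field_simp
  ring

theorem hardGap_mul_rpow_div_le_expectedRegret (hε : 0 < ε) (hT : 3 ^ N ≤ T)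
    (hY : IsRewardTable P (rewardLaw (hardGap N T) p) Y)
    (hA : ∀ t a, MeasurableSet (A t ⁻¹' {a}))
    (hrun : ∀ᵐ ω ∂P, IsUCBRun v T (fun a n => Y a n ω) fun t => A t ω) :
    hardGap N T * ((T : ℝ) ^ (1 - ε) / (6 * horizonThreshold ε)) ≤
      expectedRegret P (armMean (hardGap N T) p) A T := by
  have hTpos : 0 < T := (pow_pos three_pos N).trans_le hT
  have hgap := (hardGap_pos (N := N) hTpos).le
  have hthreshold := one_le_horizonThreshold hε
  rcases le_or_gt ((T : ℝ) ^ (1 - ε)) (horizonThreshold ε * 3 ^ N) with hshort | hlong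
  · calc hardGap N T * ((T : ℝ) ^ (1 - ε) / (6 * horizonThreshold ε))
        ≤ hardGap N T * (horizonThreshold ε * 3 ^ N / (6 * horizonThreshold ε)) := by gcongr
      _ = hardGap N T * (3 ^ N / 6) := by field_simp
      _ ≤ hardGap N T * (3 ^ N / 3) := by gcongr; norm_num
      _ ≤ _ := mul_pow_div_three_le_expectedRegret hgap hT hA hrun
  · calc hardGap N T * ((T : ℝ) ^ (1 - ε) / (6 * horizonThreshold ε))
        ≤ hardGap N T * ((T : ℝ) ^ (1 - ε) / 6) := by gcongr; linarith
      _ ≤ _ := hardGap_mul_rpow_div_six_le_expectedRegret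
        (isLongHorizon_of_horizonThreshold_mul_lt hε (one_le_pow₀ (by norm_num)) hTpos hlong)
        hY hA hrun

end LowerBound

end CausalBandit

theorem theorem4 (ε : ℝ) (hε : 0 < ε) :
    ∃ C : ℝ, 0 < C ∧
      ∀ (N : ℕ) [NeZero N] (T : ℕ), 3 ^ N ≤ T →
        ∃ Δ : ℝ, 0 < Δ ∧ 2 * Δ ≤ 1 ∧
          ∀ (p : Fin N → unitInterval) (v : CausalBandit.UCBVersion)
            (Ω : Type*) [MeasurableSpace Ω] (P : Measure Ω) [IsProbabilityMeasure P]
            (Y : CausalBandit.Intervention N → ℕ → Ω → ℝ)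
            (A : ℕ → Ω → CausalBandit.Intervention N),
            CausalBandit.IsRewardTable P (CausalBandit.rewardLaw Δ p) Y →
            (∀ t a, MeasurableSet (A t ⁻¹' {a})) →
            (∀ᵐ ω ∂P, CausalBandit.IsUCBRun v T (fun a n => Y a n ω) (fun t => A t ω)) →
            C * Real.sqrt (3 ^ N) * (T : ℝ) ^ (1 / 2 - ε) ≤
              CausalBandit.expectedRegret P (CausalBandit.armMean Δ p) A T := by
  have hthreshold := CausalBandit.one_le_horizonThreshold hε
  refine ⟨1 / (12 * CausalBandit.horizonThreshold ε), by positivity, fun N _ T hT => ?_⟩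
  have hTpos : 0 < T := (pow_pos three_pos N).trans_le hT
  refine ⟨CausalBandit.hardGap N T, CausalBandit.hardGap_pos hTpos,
    CausalBandit.two_mul_hardGap_le_one hT,
    fun p v Ω _ P _ Y A hY hA hrun => ?_⟩
  calc 1 / (12 * CausalBandit.horizonThreshold ε) * √(3 ^ N) * (T : ℝ) ^ (1 / 2 - ε)
      = CausalBandit.hardGap N T *
          ((T : ℝ) ^ (1 - ε) / (6 * CausalBandit.horizonThreshold ε)) := by
        rw [mul_assoc, CausalBandit.sqrt_mul_rpow_eq_two_mul_hardGap_mul_rpow hTpos]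
        field_simp
        ring
    _ ≤ _ := CausalBandit.hardGap_mul_rpow_div_le_expectedRegret hε hT hY hA hrun
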